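/- Let $n\ge 2$ and let $J\in M_n(\mathbb C)$ be nilpotent. Let $\mathrm{nil}_2=\{M\in M_n(\mathbb C): M^2=0\}$ and $\mathfrak c(\mathrm{nil}_2)=\{MN-NM : M,N\in \mathrm{nil}_2\}$, and for $k\ge 1$ let $J_k$ be the $k\times k$ nilpotent Jordan cell (ones on the superdiagonal, zeros elsewhere). (i) $J\in\mathfrak c(\mathrm{nil}_2)$ if and only if $J$ has a square root, i.e. there is $X\in M_n(\mathbb C)$ with $X^2=J$. (ii) There are an integer $d$ and integers $\kappa_1\ge\kappa_2\ge\dots\ge\kappa_d\ge 1$ such that $J$ is similar to $J_{\kappa_1}\oplus\dots\oplus J_{\kappa_d}$; and for every such choice, $J\in\mathfrak c(\mathrm{nil}_2)$ if and only if $\kappa_{2j-1}-\kappa_{2j}\le 1$ for all $1\le j\le\lfloor d/2\rfloor$ and, in case $d$ is odd, $\kappa_d=1$. -/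

import Mathlib

/-- The set `nil₂` of square-zero elements of a ring. -/
def squareZeroSet (R : Type*) [Ring R] : Set R := {M | M ^ 2 = 0}

/-- `𝔠(Ω)`: the set of all commutators `A B - B A` of elements of `Ω`. -/
def commutatorsOf {R : Type*} [Ring R] (Ω : Set R) : Set R :=
  {T | ∃ A ∈ Ω, ∃ B ∈ Ω, T = A * B - B * A}

/-- The nilpotent Jordan cell of size `k`: ones on the superdiagonal, zeros elsewhere. -/
def jordanCell (k : ℕ) : Matrix (Fin k) (Fin k) ℂ :=
  Matrix.of fun i j => if (i : ℕ) + 1 = (j : ℕ) then 1 else 0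

/-- The direct sum of the nilpotent Jordan cells of sizes `κ 0, …, κ (d - 1)`. -/
def jordanSum {d : ℕ} (κ : Fin d → ℕ) :
    Matrix (Σ i : Fin d, Fin (κ i)) (Σ i : Fin d, Fin (κ i)) ℂ :=
  Matrix.blockDiagonal' fun i => jordanCell (κ i)

/-- `κ 0 ≥ κ 1 ≥ … ≥ κ (d - 1) ≥ 1` are the Jordan block sizes, in decreasing order, of the
nilpotent matrix `J`: after an identification of the index sets, `J` is similar to the direct sum
of the nilpotent Jordan cells of these sizes. -/
def HasJordanBlockSizes {n d : ℕ} (J : Matrix (Fin n) (Fin n) ℂ) (κ : Fin d → ℕ) : Prop :=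
  Antitone κ ∧ (∀ i, 1 ≤ κ i) ∧
    ∃ e : (Σ i : Fin d, Fin (κ i)) ≃ Fin n,
      IsConj J (Matrix.reindex e e (jordanSum κ))

/-- The sizes, paired off consecutively as `(κ 0, κ 1), (κ 2, κ 3), …`, differ by at most one
within each pair (for decreasing `κ`), and if their number `d` is odd, then the last, unpaired
one is equal to `1`. -/
def PairedSizes {d : ℕ} (κ : Fin d → ℕ) : Prop :=
  (∀ (j : ℕ) (h : 2 * j + 1 < d), κ ⟨2 * j, by omega⟩ ≤ κ ⟨2 * j + 1, h⟩ + 1) ∧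
    ∀ (j : ℕ) (h : 2 * j + 1 = d), κ ⟨2 * j, by omega⟩ = 1

/-! Both being a commutator of square-zero matrices and having a square root are shown equivalent to
`PairedSizes`, on the Jordan model `jordanSum κ`.

Necessity: the increment `dim ker f ^ (k + 1) - dim ker f ^ k` counts the blocks of size `> k`. If
the pairing fails, two successive increments are equal and odd. This is impossible in both cases.
For `f = g ^ 2` each increment is a sum of two consecutive terms of the decreasing increment
sequence of `g`, so equality makes the terms coincide (`even_finrank_ker_pow_sub_of_sq`). For `f = M
N - N M`, the maps `M`, `N` anticommute with `f`, hence act on `ker f ^ (k + 1) / ker f ^ k`, where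
they commute; equal increments let one lift through `f`, which makes `N` exact on the homology of
`M`, and the dimension is even (`even_finrank_ker_pow_sub_of_commutator`).

Sufficiency: zigzagging between two paired Jordan chains gives square-zero `A`, `B` with `A B + B A
= J`. Then `(A + B) ^ 2 = J`, and twisting both by a diagonal sign matrix turns the anticommutator
into a commutator. -/

open Module

/-! ### Parity of kernel increments for squares and for commutators. -/

section KernelDimensions

variable {K V : Type*} [Field K] [AddCommGroup V] [Module K V] [FiniteDimensional K V]

theorem finrank_map_add_finrank_inf_ker {W : Type*} [AddCommGroup W] [Module K W]
    (f : V →ₗ[K] W) (S : Submodule K V) :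
    finrank K (S.map f) + finrank K ↥(S ⊓ LinearMap.ker f) = finrank K S := by
  have h := LinearMap.finrank_range_add_finrank_ker (f ∘ₗ S.subtype)
  rw [LinearMap.range_comp, Submodule.range_subtype, LinearMap.ker_comp,
    ← Submodule.finrank_map_subtype_eq, Submodule.map_comap_subtype] at h
  exact h

/-- The dimension of the image of `ker f ^ (k + 2)` under `f`, modulo `ker f ^ k`. -/
theorem finrank_map_ker_pow_sup (f : End K V) (k : ℕ) :
    finrank K ↥((LinearMap.ker (f ^ (k + 2))).map f ⊔ LinearMap.ker (f ^ k)) +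
      finrank K (LinearMap.ker (f ^ (k + 1))) =
    finrank K (LinearMap.ker (f ^ (k + 2))) + finrank K (LinearMap.ker (f ^ k)) := by
  have key : ∀ m : ℕ, finrank K ((LinearMap.ker (f ^ (m + 1))).map f) +
      finrank K (LinearMap.ker f) = finrank K (LinearMap.ker (f ^ (m + 1))) := by
    intro m
    have h := finrank_map_add_finrank_inf_ker f (LinearMap.ker (f ^ (m + 1)))
    have h2 : LinearMap.ker (f ^ (m + 1)) ⊓ LinearMap.ker f = LinearMap.ker f := by
      rw [inf_eq_right, pow_succ]
      exact LinearMap.ker_le_ker_comp _ _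
    rw [h2] at h
    exact h
  -- The overlap is again the image under `f` of a kernel, so inclusion-exclusion involves only
  -- kernel dimensions; the two copies of `dim ker f` cancel.
  have hinf : (LinearMap.ker (f ^ (k + 2))).map f ⊓ LinearMap.ker (f ^ k) =
      (LinearMap.ker (f ^ (k + 1))).map f := by
    ext x
    simp only [Submodule.mem_inf, Submodule.mem_map, LinearMap.mem_ker]
    constructor
    · rintro ⟨⟨y, -, rfl⟩, hx⟩
      exact ⟨y, by simpa [pow_succ] using hx, rfl⟩
    · rintro ⟨y, hy, rfl⟩
      refine ⟨⟨y, ?_, rfl⟩, by simpa [pow_succ] using hy⟩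
      rw [pow_succ', Module.End.mul_apply, hy, map_zero]
  have h1 := Submodule.finrank_sup_add_finrank_inf_eq
    ((LinearMap.ker (f ^ (k + 2))).map f) (LinearMap.ker (f ^ k))
  rw [hinf] at h1
  have h2 := key k
  have h3 : _ = finrank K (LinearMap.ker (f ^ (k + 2))) := key (k + 1)
  change finrank K ((LinearMap.ker (f ^ (k + 2))).map f) + _ = _ at h3
  omega

omit [FiniteDimensional K V] in
theorem map_ker_pow_sup_le (f : End K V) (k : ℕ) :
    (LinearMap.ker (f ^ (k + 2))).map f ⊔ LinearMap.ker (f ^ k) ≤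
      LinearMap.ker (f ^ (k + 1)) := by
  refine sup_le ?_ ?_
  · rintro _ ⟨y, hy, rfl⟩
    simpa [pow_succ] using hy
  · intro x hx
    rw [LinearMap.mem_ker] at hx ⊢
    rw [pow_succ', Module.End.mul_apply, hx, map_zero]

/-- The sequence `k ↦ dim ker f ^ k` is concave. -/
theorem finrank_ker_pow_concave (f : End K V) (k : ℕ) :
    finrank K (LinearMap.ker (f ^ (k + 2))) + finrank K (LinearMap.ker (f ^ k)) ≤
      2 * finrank K (LinearMap.ker (f ^ (k + 1))) := by
  have h1 := finrank_map_ker_pow_sup f k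
  have h2 := Submodule.finrank_mono (map_ker_pow_sup_le f k)
  omega

/-- Two equal successive increments of `k ↦ dim ker (g ^ 2) ^ k` are even. -/
theorem even_finrank_ker_pow_sub_of_sq {f g : End K V} (hfg : g ^ 2 = f) (k : ℕ)
    (h : finrank K (LinearMap.ker (f ^ (k + 2))) + finrank K (LinearMap.ker (f ^ k)) =
      2 * finrank K (LinearMap.ker (f ^ (k + 1)))) :
    Even (finrank K (LinearMap.ker (f ^ (k + 1))) - finrank K (LinearMap.ker (f ^ k))) := by
  subst hfg
  -- With `a i` the decreasing increments for `g`, the hypothesis is `a (2k) + a (2k+1) = a (2k+2) +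
  -- a (2k+3)`, so all four agree and the sum is `2 * a (2k)`.
  have h0 := finrank_ker_pow_concave g (2 * k)
  have h1 : finrank K (LinearMap.ker (g ^ (2 * k + 3))) + _ ≤
      2 * finrank K (LinearMap.ker (g ^ (2 * k + 2))) := finrank_ker_pow_concave g (2 * k + 1)
  have h2 : finrank K (LinearMap.ker (g ^ (2 * k + 4))) + _ ≤
      2 * finrank K (LinearMap.ker (g ^ (2 * k + 3))) := finrank_ker_pow_concave g (2 * k + 2)
  have e0 : (g ^ 2) ^ k = g ^ (2 * k) := (pow_mul _ _ _).symm
  have e1 : (g ^ 2) ^ (k + 1) = g ^ (2 * k + 2) := (pow_mul _ _ _).symm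
  have e2 : (g ^ 2) ^ (k + 2) = g ^ (2 * k + 4) := (pow_mul _ _ _).symm
  rw [e0, e1, e2] at h
  rw [e0, e1]
  rw [Nat.even_iff]
  omega

/-- If `m` and `n` are commuting endomorphisms with `m ^ 2 = n ^ 2 = 0`, such that `n` is exact
on the homology of `m`, then the dimension is even. -/
theorem even_finrank_of_exact_on_homology {m n : End K V} (hm : m * m = 0)
    (hn : n * n = 0) (hmn : m * n = n * m)
    (hex : ∀ x, m x = 0 → n x ∈ LinearMap.range m → ∃ u v, m v = 0 ∧ x = m u + n v) :
    Even (finrank K V) := by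
  have hm' (x : V) : m (m x) = 0 := LinearMap.congr_fun hm x
  have hn' (x : V) : n (n x) = 0 := LinearMap.congr_fun hn x
  have hmn' (x : V) : m (n x) = n (m x) := LinearMap.congr_fun hmn x
  -- On `H = ker m / range m`, the kernel of the map induced by `n` equals its image, so `dim H` is
  -- even; and `dim V = dim H + 2 * rank m`.
  have hL : LinearMap.ker m ⊓ LinearMap.ker ((LinearMap.range m).mkQ ∘ₗ n) =
      (LinearMap.ker m).map n ⊔ LinearMap.range m := by
    ext x
    simp only [Submodule.mem_inf, LinearMap.mem_ker, LinearMap.comp_apply, Submodule.mkQ_apply,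
      Submodule.Quotient.mk_eq_zero, Submodule.mem_sup, Submodule.mem_map, LinearMap.mem_range]
    constructor
    · rintro ⟨h1, h2⟩
      obtain ⟨u, v, hv, rfl⟩ := hex x h1 h2
      exact ⟨n v, ⟨v, hv, rfl⟩, m u, ⟨u, rfl⟩, add_comm _ _⟩
    · rintro ⟨_, ⟨v, hv, rfl⟩, _, ⟨u, rfl⟩, rfl⟩
      refine ⟨by rw [map_add, hm', hmn', hv, map_zero, add_zero], n u, ?_⟩
      rw [map_add, hn', hmn', zero_add]
  have h1 := finrank_map_add_finrank_inf_ker ((LinearMap.range m).mkQ ∘ₗ n)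
    (LinearMap.ker m)
  rw [hL, Submodule.map_comp] at h1
  have h2 := finrank_map_add_finrank_inf_ker (LinearMap.range m).mkQ
    ((LinearMap.ker m).map n ⊔ LinearMap.range m)
  rw [Submodule.ker_mkQ, inf_eq_right.2 le_sup_right, Submodule.map_sup, Submodule.mkQ_map_self,
    sup_bot_eq] at h2
  have h3 := LinearMap.finrank_range_add_finrank_ker m
  exact ⟨finrank K ↥((LinearMap.ker m).map n ⊔ LinearMap.range m), by omega⟩

/-- Two equal successive increments of `k ↦ dim ker f ^ k` are even if `f` is a commutator of
square-zero endomorphisms. -/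
theorem even_finrank_ker_pow_sub_of_commutator {M N f : End K V} (hM : M * M = 0)
    (hN : N * N = 0) (hf : f = M * N - N * M) (k : ℕ)
    (h : finrank K (LinearMap.ker (f ^ (k + 2))) + finrank K (LinearMap.ker (f ^ k)) =
      2 * finrank K (LinearMap.ker (f ^ (k + 1)))) :
    Even (finrank K (LinearMap.ker (f ^ (k + 1))) - finrank K (LinearMap.ker (f ^ k))) := by
  have hMM (x : V) : M (M x) = 0 := LinearMap.congr_fun hM x
  have hNN (x : V) : N (N x) = 0 := LinearMap.congr_fun hN x
  have hfa (x : V) : f x = M (N x) - N (M x) := by rw [hf]; rfl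
  have hfM (x : V) : f (M x) = -M (f x) := by simp [hfa, hMM]
  have hfN (x : V) : f (N x) = -N (f x) := by simp [hfa, hNN]
  have hMk (j : ℕ) (x : V) (hx : (f ^ j) x = 0) : (f ^ j) (M x) = 0 := by
    induction j generalizing x with
    | zero => simp_all
    | succ j ih =>
      rw [pow_succ, Module.End.mul_apply] at hx ⊢
      rw [hfM, map_neg, ih _ hx, neg_zero]
  have hNk (j : ℕ) (x : V) (hx : (f ^ j) x = 0) : (f ^ j) (N x) = 0 := by
    induction j generalizing x with
    | zero => simp_all
    | succ j ih =>
      rw [pow_succ, Module.End.mul_apply] at hx ⊢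
      rw [hfN, map_neg, ih _ hx, neg_zero]
  have hsucc (j : ℕ) (x : V) (hx : (f ^ j) (f x) = 0) : (f ^ (j + 1)) x = 0 := by
    rwa [pow_succ]
  set P := LinearMap.ker (f ^ k) with hP
  set Q := LinearMap.ker (f ^ (k + 1)) with hQ
  set U := LinearMap.ker (f ^ (k + 2)) with hU
  have hPQ : P ≤ Q := le_sup_right.trans (map_ker_pow_sup_le f k)
  -- Equality of the increments says exactly that `f` maps `U` onto `Q` modulo `P`.
  have hsup : U.map f ⊔ P = Q := by
    refine Submodule.eq_of_le_of_finrank_eq (map_ker_pow_sup_le f k) ?_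
    have := finrank_map_ker_pow_sup f k
    rw [← hP, ← hQ, ← hU] at this
    omega
  let M₁ : End K Q := M.restrict fun x hx => hMk (k + 1) x hx
  let N₁ : End K Q := N.restrict fun x hx => hNk (k + 1) x hx
  let P₁ : Submodule K Q := P.comap Q.subtype
  have hM₁ : P₁ ≤ P₁.comap M₁ := fun x hx => hMk k x hx
  have hN₁ : P₁ ≤ P₁.comap N₁ := fun x hx => hNk k x hx
  have hlift (x : V) (hx : x ∈ Q) : ∃ y ∈ U, x - f y ∈ P := by
    rw [← hsup, Submodule.mem_sup] at hx
    obtain ⟨_, ⟨y, hy, rfl⟩, p, hp, rfl⟩ := hx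
    exact ⟨y, hy, by simpa using hp⟩
  have hfQ (y : V) (hy : f y ∈ P) : y ∈ Q := hsucc k y hy
  have heven : Even (finrank K (Q ⧸ P₁)) := by
    refine even_finrank_of_exact_on_homology (m := P₁.mapQ P₁ M₁ hM₁) (n := P₁.mapQ P₁ N₁ hN₁)
      ?_ ?_ ?_ ?_
    · ext x
      exact congrArg P₁.mkQ (Subtype.ext (hMM x))
    · ext x
      exact congrArg P₁.mkQ (Subtype.ext (hNN x))
    · ext x
      refine (Submodule.Quotient.eq P₁).2 ?_
      change M (N x) - N (M x) ∈ P
      rw [← hfa]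
      have hx : (f ^ (k + 1)) x = 0 := x.2
      rwa [pow_succ] at hx
    · intro x
      obtain ⟨x, rfl⟩ := P₁.mkQ_surjective x
      rintro hx ⟨z, hz⟩
      obtain ⟨z, rfl⟩ := P₁.mkQ_surjective z
      have hMx : M x ∈ P := (Submodule.Quotient.mk_eq_zero P₁).1 hx
      have hNx : M z - N x ∈ P := (Submodule.Quotient.eq P₁).1 hz
      -- Modulo `P`, `x = f y = M (N y) - N (M y)`. Since `M y` lies in `Q` but `N y` need not, `N
      -- y` is corrected by `M w`, which `M` kills.
      obtain ⟨y, -, hyP⟩ := hlift x x.2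
      obtain ⟨w, -, hwP⟩ := hlift z z.2
      have hMy : M y ∈ Q := by
        refine hfQ _ ?_
        rw [hfM]
        refine neg_mem ?_
        have := sub_mem hMx (hMk k _ hyP)
        simpa using this
      have hNy : N y - M w ∈ Q := by
        refine hfQ _ ?_
        have h1 := add_mem (sub_mem hNx (hMk k _ hwP)) (hNk k _ hyP)
        have h2 : f (N y - M w) = M z - N x - M (z - f w) + N (x - f y) := by
          rw [map_sub, hfM, hfN, map_sub, map_sub]; abel
        rw [h2]
        exact h1
      refine ⟨P₁.mkQ ⟨_, hNy⟩, P₁.mkQ (-⟨_, hMy⟩), ?_, ?_⟩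
      · refine congrArg P₁.mkQ (Subtype.ext ?_) |>.trans (map_zero _)
        change M (-M y) = 0
        rw [map_neg, hMM, neg_zero]
      · refine (Submodule.Quotient.eq P₁).2 ?_
        change (x : V) - (M (N y - M w) + N (-M y)) ∈ P
        have h2 : (x : V) - (M (N y - M w) + N (-M y)) = x - f y := by
          rw [hfa, map_sub, map_neg, hMM, sub_zero, ← sub_eq_add_neg]
        rw [h2]
        exact hyP
  have h1 := Submodule.finrank_quotient_add_finrank P₁
  have h2 : finrank K P₁ = finrank K P := (Submodule.comapSubtypeEquivOfLe hPQ).finrank_eq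
  rwa [← h1, h2, Nat.add_sub_cancel]

end KernelDimensions

/-! ### Transport of both properties along ring isomorphisms. -/

section Invariance

variable {R S : Type*} [Ring R] [Ring S]

theorem map_mem_commutatorsOf_squareZeroSet (φ : R →+* S) {T : R}
    (h : T ∈ commutatorsOf (squareZeroSet R)) : φ T ∈ commutatorsOf (squareZeroSet S) := by
  obtain ⟨A, hA, B, hB, rfl⟩ := h
  refine ⟨φ A, ?_, φ B, ?_, by simp⟩
  · change φ A ^ 2 = 0
    rw [← map_pow, show A ^ 2 = 0 from hA, map_zero]
  · change φ B ^ 2 = 0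
    rw [← map_pow, show B ^ 2 = 0 from hB, map_zero]

theorem RingEquiv.mem_commutatorsOf_squareZeroSet_iff (φ : R ≃+* S) {T : R} :
    φ T ∈ commutatorsOf (squareZeroSet S) ↔ T ∈ commutatorsOf (squareZeroSet R) :=
  ⟨fun h => by simpa using map_mem_commutatorsOf_squareZeroSet φ.symm.toRingHom h,
    map_mem_commutatorsOf_squareZeroSet φ.toRingHom⟩

theorem RingEquiv.exists_sq_eq_iff (φ : R ≃+* S) {T : R} :
    (∃ X, X ^ 2 = φ T) ↔ ∃ X, X ^ 2 = T :=
  ⟨fun ⟨X, hX⟩ => ⟨φ.symm X, by rw [← map_pow, hX, φ.symm_apply_apply]⟩,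
    fun ⟨X, hX⟩ => ⟨φ X, by rw [← map_pow, hX]⟩⟩

theorem IsConj.exists_ringEquiv {a b : R} (h : IsConj a b) : ∃ φ : R ≃+* R, φ a = b := by
  obtain ⟨c, hc⟩ := h
  refine ⟨MulSemiringAction.toRingEquiv (ConjAct Rˣ) R (ConjAct.toConjAct c), ?_⟩
  rw [MulSemiringAction.toRingEquiv_apply_apply, ConjAct.units_smul_def, ConjAct.ofConjAct_toConjAct,
    hc.eq, Units.mul_inv_cancel_right]

theorem HasJordanBlockSizes.exists_ringEquiv {n d : ℕ} {J : Matrix (Fin n) (Fin n) ℂ}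
    {κ : Fin d → ℕ} (h : HasJordanBlockSizes J κ) :
    ∃ φ : Matrix (Fin n) (Fin n) ℂ ≃+*
      Matrix (Σ i : Fin d, Fin (κ i)) (Σ i : Fin d, Fin (κ i)) ℂ, φ J = jordanSum κ := by
  obtain ⟨-, -, e, he⟩ := h
  obtain ⟨φ, hφ⟩ := he.exists_ringEquiv
  refine ⟨φ.trans (Matrix.reindexAlgEquiv ℂ ℂ e).symm.toRingEquiv, ?_⟩
  change (Matrix.reindexAlgEquiv ℂ ℂ e).symm (φ J) = _
  rw [hφ, AlgEquiv.symm_apply_eq]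
  rfl

end Invariance

/-! ### Matrices of partial maps on the basis, with composition as product. -/

section PartialMap

variable {ι : Type*} [DecidableEq ι]

/-- The `0`-`1`-matrix sending the basis vector `y` to the basis vector `f y` or to zero. -/
def partialMapMatrix (f : ι → Option ι) : Matrix ι ι ℂ :=
  Matrix.of fun x y => if f y = some x then 1 else 0

theorem partialMapMatrix_apply (f : ι → Option ι) (x y : ι) :
    partialMapMatrix f x y = if f y = some x then 1 else 0 := rfl

theorem partialMapMatrix_none : partialMapMatrix (fun _ : ι => none) = 0 := by
  ext x y
  simp [partialMapMatrix_apply]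

theorem partialMapMatrix_some : partialMapMatrix (fun x : ι => some x) = 1 := by
  ext x y
  simp [partialMapMatrix_apply, Matrix.one_apply, eq_comm]

theorem partialMapMatrix_mul [Fintype ι] (f g : ι → Option ι) :
    partialMapMatrix f * partialMapMatrix g = partialMapMatrix fun y => (g y).bind f := by
  ext x y
  rw [Matrix.mul_apply]
  simp only [partialMapMatrix_apply]
  cases h : g y with
  | none => simp
  | some z => simp

end PartialMap

/-! ### Kernel dimensions of the Jordan model and necessity of the pairing. -/

section JordanSum

variable {d : ℕ} (κ : Fin d → ℕ)

/-- Moving down `k` steps in each Jordan chain. -/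
def jordanShift (k : ℕ) (x : Σ i : Fin d, Fin (κ i)) : Option (Σ i : Fin d, Fin (κ i)) :=
  if k ≤ x.2 then some ⟨x.1, ⟨x.2 - k, by omega⟩⟩ else none

theorem jordanSum_eq_partialMapMatrix :
    jordanSum κ = partialMapMatrix (jordanShift κ 1) := by
  ext ⟨i, a⟩ ⟨j, b⟩
  rw [partialMapMatrix_apply, jordanSum]
  by_cases h : i = j
  · subst h
    rw [Matrix.blockDiagonal'_apply_eq]
    simp only [jordanCell, Matrix.of_apply, jordanShift]
    refine if_congr ?_ rfl rfl
    split_ifs with hb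
    · simp only [Option.some.injEq, Sigma.mk.injEq, heq_eq_eq, true_and, Fin.ext_iff]
      omega
    · simp only [iff_false]
      omega
  · rw [Matrix.blockDiagonal'_apply_ne _ _ _ h, if_neg]
    unfold jordanShift
    split_ifs
    · simp only [Option.some.injEq, Sigma.mk.injEq, not_and]
      exact fun h' => absurd h'.symm h
    · simp

theorem jordanSum_pow (k : ℕ) :
    jordanSum κ ^ k = partialMapMatrix (jordanShift κ k) := by
  induction k with
  | zero =>
    rw [pow_zero, ← partialMapMatrix_some]
    congr 1
  | succ k ih =>
    rw [pow_succ, ih, jordanSum_eq_partialMapMatrix, partialMapMatrix_mul]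
    congr 1
    ext1 ⟨i, a⟩
    by_cases h1 : 1 ≤ (a : ℕ)
    · by_cases h2 : k + 1 ≤ (a : ℕ)
      · have h3 : k ≤ (a : ℕ) - 1 := by omega
        simp [jordanShift, h1, h2, h3, Nat.sub_sub, add_comm]
      · have h3 : ¬ k ≤ (a : ℕ) - 1 := by omega
        simp [jordanShift, h1, h2, h3]
    · have h2 : ¬ k + 1 ≤ (a : ℕ) := by omega
      simp [jordanShift, h1, h2]

theorem ker_toLin'_jordanSum_pow (k : ℕ) :
    LinearMap.ker (Matrix.toLin' (jordanSum κ) ^ k) =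
      LinearMap.ker (LinearMap.funLeft ℂ ℂ
        (Subtype.val : {x : Σ i : Fin d, Fin (κ i) // k ≤ x.2} → Σ i : Fin d, Fin (κ i))) := by
  ext v
  rw [← Matrix.toLin'_pow, jordanSum_pow, LinearMap.mem_ker, LinearMap.mem_ker, funext_iff,
    funext_iff, Matrix.toLin'_apply]
  have hsum (x) : (partialMapMatrix (jordanShift κ k)).mulVec v x =
      ∑ y, if jordanShift κ k y = some x then v y else 0 := by
    simp [Matrix.mulVec, dotProduct, partialMapMatrix_apply]
  simp only [hsum, Pi.zero_apply, LinearMap.funLeft_apply, Subtype.forall]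
  constructor
  · intro h y hy
    have hy' : jordanShift κ k y = some ⟨y.1, ⟨y.2 - k, by omega⟩⟩ := if_pos hy
    rw [← h ⟨y.1, ⟨y.2 - k, by omega⟩⟩, Finset.sum_eq_single y, if_pos hy']
    · intro z _ hz
      refine if_neg fun hz' => hz ?_
      unfold jordanShift at hz'
      split_ifs at hz' with hk
      obtain ⟨i, a⟩ := y
      obtain ⟨j, b⟩ := z
      simp only [Option.some.injEq, Sigma.mk.injEq] at hz'
      obtain ⟨rfl, hz'⟩ := hz'
      simp only [heq_eq_eq, Fin.mk.injEq] at hz'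
      dsimp only at hk hy
      congr 1
      exact Fin.ext (by omega)
    · simp
  · intro h x
    refine Finset.sum_eq_zero fun y _ => ?_
    split_ifs with hy
    · refine h y ?_
      by_contra hk
      simp [jordanShift, hk] at hy
    · rfl

/-- The kernel of the `k`-th power consists of the vectors supported on levels `< k`; passing to `k
+ 1` adds one basis vector, that of level `k`, for each block of size `> k`. -/
theorem finrank_ker_toLin'_jordanSum_pow_succ (k : ℕ) :
    finrank ℂ (LinearMap.ker (Matrix.toLin' (jordanSum κ) ^ (k + 1))) =
      finrank ℂ (LinearMap.ker (Matrix.toLin' (jordanSum κ) ^ k)) +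
        (Finset.univ.filter fun i => k < κ i).card := by
  have hrank (k : ℕ) : Fintype.card {x : Σ i : Fin d, Fin (κ i) // k ≤ x.2} +
      finrank ℂ (LinearMap.ker (Matrix.toLin' (jordanSum κ) ^ k)) =
        Fintype.card (Σ i : Fin d, Fin (κ i)) := by
    rw [ker_toLin'_jordanSum_pow]
    have h := LinearMap.finrank_range_add_finrank_ker (LinearMap.funLeft ℂ ℂ
      (Subtype.val : {x : Σ i : Fin d, Fin (κ i) // k ≤ x.2} → Σ i : Fin d, Fin (κ i)))
    rwa [LinearMap.range_eq_top.2 (LinearMap.funLeft_surjective_of_injective _ _ _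
      Subtype.val_injective), finrank_top, finrank_fintype_fun_eq_card,
      finrank_fintype_fun_eq_card] at h
  have hcard : Fintype.card {x : Σ i : Fin d, Fin (κ i) // k ≤ x.2} =
      Fintype.card {x : Σ i : Fin d, Fin (κ i) // k + 1 ≤ x.2} +
        (Finset.univ.filter fun i => k < κ i).card := by
    have h1 : (Finset.univ.filter fun i => k < κ i).card =
        (Finset.univ.filter fun x : Σ i : Fin d, Fin (κ i) => (x.2 : ℕ) = k).card := by
      refine Finset.card_bij' (fun i hi => ⟨i, ⟨k, by simpa using hi⟩⟩) (fun x _ => x.1)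
        ?_ ?_ ?_ ?_
      · simp
      · rintro ⟨i, a⟩ hx
        simp only [Finset.mem_filter, Finset.mem_univ, true_and] at hx ⊢
        omega
      · simp
      · rintro ⟨i, a⟩ hx
        simp only [Finset.mem_filter, Finset.mem_univ, true_and] at hx
        subst hx
        rfl
    rw [h1, Fintype.card_subtype, Fintype.card_subtype, ← Finset.card_union_of_disjoint]
    · congr 1
      ext x
      simp only [Finset.mem_filter, Finset.mem_univ, true_and, Finset.mem_union]
      omega
    · rw [Finset.disjoint_filter]
      intro x _ h
      omega
  have h1 := hrank k
  have h2 := hrank (k + 1)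
  omega

variable {κ}

/-- A violation of the pairing is a drop of at least two (to `0` past the last block) after an odd
number of blocks, so two consecutive levels lie in the gap and have the same odd count. -/
theorem pairedSizes_of_even_card (hκ : Antitone κ) (hpos : ∀ i, 1 ≤ κ i)
    (h : ∀ k, (Finset.univ.filter fun i => k + 1 < κ i).card =
      (Finset.univ.filter fun i => k < κ i).card →
        Even (Finset.univ.filter fun i => k < κ i).card) : PairedSizes κ := by
  constructor
  · intro j hj
    by_contra! hlt
    set a : Fin d := ⟨2 * j, by omega⟩
    set b : Fin d := ⟨2 * j + 1, hj⟩
    have hset (k : ℕ) (h1 : κ b ≤ k) (h2 : k < κ a) :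
        (Finset.univ.filter fun i => k < κ i) = Finset.Iic a := by
      ext i
      simp only [Finset.mem_filter, Finset.mem_univ, true_and, Finset.mem_Iic]
      constructor
      · intro hi
        by_contra! hia
        have hbi : b ≤ i := by
          rw [Fin.lt_def] at hia
          rw [Fin.le_def]
          exact hia
        exact absurd (hκ hbi) (by omega)
      · intro hi
        exact h2.trans_le (hκ hi)
    -- The levels `κ b` and `κ b + 1` both lie below `κ a`, so each is exceeded by exactly the `2 *
    -- j + 1` blocks up to `a`.
    have h1 := hset (κ b) le_rfl (by omega)
    have h2 := hset (κ b + 1) (by omega) hlt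
    have h3 := h (κ b) (by rw [h1, h2])
    rw [h1, Fin.card_Iic, Nat.even_iff] at h3
    change (2 * j + 1) % 2 = 0 at h3
    omega
  · intro j hj
    set a : Fin d := ⟨2 * j, by omega⟩
    by_contra hne
    have hle (i : Fin d) : κ a ≤ κ i := hκ (by rw [Fin.le_def]; change (i : ℕ) ≤ 2 * j; omega)
    have hset (k : ℕ) (h2 : k < κ a) :
        (Finset.univ.filter fun i => k < κ i) = Finset.univ := by
      ext i
      simpa using h2.trans_le (hle i)
    have ha := hpos a
    have h1 := hset 0 (by omega)
    have h2 := hset 1 (by omega)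
    have h3 := h 0 (by rw [h1, h2])
    rw [h1, Finset.card_univ, Fintype.card_fin, Nat.even_iff] at h3
    omega

theorem pairedSizes_of_even_finrank (hκ : Antitone κ) (hpos : ∀ i, 1 ≤ κ i)
    (h : ∀ k, finrank ℂ (LinearMap.ker (Matrix.toLin' (jordanSum κ) ^ (k + 2))) +
      finrank ℂ (LinearMap.ker (Matrix.toLin' (jordanSum κ) ^ k)) =
        2 * finrank ℂ (LinearMap.ker (Matrix.toLin' (jordanSum κ) ^ (k + 1))) →
      Even (finrank ℂ (LinearMap.ker (Matrix.toLin' (jordanSum κ) ^ (k + 1))) -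
        finrank ℂ (LinearMap.ker (Matrix.toLin' (jordanSum κ) ^ k)))) : PairedSizes κ := by
  refine pairedSizes_of_even_card hκ hpos fun k hk => ?_
  have h1 := finrank_ker_toLin'_jordanSum_pow_succ κ k
  have h2 := finrank_ker_toLin'_jordanSum_pow_succ κ (k + 1)
  have h3 := h k (by rw [show k + 2 = k + 1 + 1 from rfl]; omega)
  rwa [h1, Nat.add_sub_cancel_left] at h3

theorem pairedSizes_of_sq_eq_jordanSum (hκ : Antitone κ) (hpos : ∀ i, 1 ≤ κ i)
    (h : ∃ X, X ^ 2 = jordanSum κ) : PairedSizes κ := by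
  obtain ⟨X, hX⟩ := h
  exact pairedSizes_of_even_finrank hκ hpos
    (even_finrank_ker_pow_sub_of_sq (g := Matrix.toLin' X) (by rw [← Matrix.toLin'_pow, hX]))

theorem pairedSizes_of_jordanSum_mem (hκ : Antitone κ) (hpos : ∀ i, 1 ≤ κ i)
    (h : jordanSum κ ∈ commutatorsOf (squareZeroSet (Matrix _ _ ℂ))) : PairedSizes κ := by
  obtain ⟨M, hM, N, hN, h⟩ := h
  have hM' : M ^ 2 = 0 := hM
  have hN' : N ^ 2 = 0 := hN
  refine pairedSizes_of_even_finrank hκ hpos (even_finrank_ker_pow_sub_of_commutator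
    (M := Matrix.toLin' M) (N := Matrix.toLin' N) ?_ ?_ ?_)
  · rw [← pow_two, ← Matrix.toLin'_pow, hM', map_zero]
  · rw [← pow_two, ← Matrix.toLin'_pow, hN', map_zero]
  · rw [h, map_sub, Matrix.toLin'_mul, Matrix.toLin'_mul]
    rfl

end JordanSum

/-! ### Zigzag construction of the square root and of the commutator. -/

section Sufficiency

variable {d : ℕ} (κ : Fin d → ℕ)

/-- From an even chain to the following odd one, one step down. -/
def evenToOdd (x : Σ i : Fin d, Fin (κ i)) : Option (Σ i : Fin d, Fin (κ i)) :=
  if h : (x.1 : ℕ) % 2 = 0 ∧ 1 ≤ (x.2 : ℕ) ∧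
      ∃ h : (x.1 : ℕ) + 1 < d, (x.2 : ℕ) - 1 < κ ⟨x.1 + 1, h⟩ then
    some ⟨⟨x.1 + 1, h.2.2.1⟩, ⟨x.2 - 1, h.2.2.2⟩⟩ else none

/-- From an odd chain to the preceding even one, on the same level. -/
def oddToEven (x : Σ i : Fin d, Fin (κ i)) : Option (Σ i : Fin d, Fin (κ i)) :=
  if h : (x.1 : ℕ) % 2 = 1 ∧ (x.2 : ℕ) < κ ⟨x.1 - 1, by omega⟩ then
    some ⟨⟨x.1 - 1, by omega⟩, ⟨x.2, h.2⟩⟩ else none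

variable {κ}

theorem evenToOdd_eq_some {x y : Σ i : Fin d, Fin (κ i)} (h : evenToOdd κ x = some y) :
    (x.1 : ℕ) % 2 = 0 ∧ (y.1 : ℕ) = x.1 + 1 ∧ (x.2 : ℕ) = y.2 + 1 := by
  unfold evenToOdd at h
  split_ifs at h with hx
  cases Option.some.inj h
  exact ⟨hx.1, rfl, (Nat.sub_add_cancel hx.2.1).symm⟩

theorem oddToEven_eq_some {x y : Σ i : Fin d, Fin (κ i)} (h : oddToEven κ x = some y) :
    (x.1 : ℕ) % 2 = 1 ∧ (y.1 : ℕ) = x.1 - 1 ∧ (x.2 : ℕ) = y.2 := by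
  unfold oddToEven at h
  split_ifs at h with hx
  cases Option.some.inj h
  exact ⟨hx.1, rfl, rfl⟩

theorem evenToOdd_of_odd {x : Σ i : Fin d, Fin (κ i)} (hx : (x.1 : ℕ) % 2 = 1) :
    evenToOdd κ x = none :=
  dif_neg fun h => by omega

theorem oddToEven_of_even {x : Σ i : Fin d, Fin (κ i)} (hx : (x.1 : ℕ) % 2 = 0) :
    oddToEven κ x = none :=
  dif_neg fun h => by omega

theorem evenToOdd_bind_evenToOdd (x : Σ i : Fin d, Fin (κ i)) :
    (evenToOdd κ x).bind (evenToOdd κ) = none := by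
  cases h : evenToOdd κ x with
  | none => rfl
  | some y =>
    have := evenToOdd_eq_some h
    exact evenToOdd_of_odd (by omega)

theorem oddToEven_bind_oddToEven (x : Σ i : Fin d, Fin (κ i)) :
    (oddToEven κ x).bind (oddToEven κ) = none := by
  cases h : oddToEven κ x with
  | none => rfl
  | some y =>
    have := oddToEven_eq_some h
    exact oddToEven_of_even (by omega)

theorem sigma_fin_ext {x y : Σ i : Fin d, Fin (κ i)} (h1 : (x.1 : ℕ) = y.1)
    (h2 : (x.2 : ℕ) = y.2) : x = y := by
  obtain ⟨i, a⟩ := x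
  obtain ⟨j, b⟩ := y
  obtain rfl : i = j := Fin.ext h1
  obtain rfl : a = b := Fin.ext h2
  rfl

/-- The even chain is at least as long as the odd one after it, so the sideways move is always
defined. -/
theorem oddToEven_bind_evenToOdd (hκ : Antitone κ) {x : Σ i : Fin d, Fin (κ i)}
    (hx : (x.1 : ℕ) % 2 = 1) : (oddToEven κ x).bind (evenToOdd κ) = jordanShift κ 1 x := by
  have hlt : (x.2 : ℕ) < κ ⟨x.1 - 1, by omega⟩ :=
    x.2.2.trans_le (hκ (Fin.le_def.2 (Nat.sub_le _ _)))
  rw [oddToEven, dif_pos ⟨hx, hlt⟩, Option.bind_some]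
  have hidx : (x.1 : ℕ) - 1 + 1 = x.1 := by omega
  have hfin : (⟨x.1 - 1 + 1, by omega⟩ : Fin d) = x.1 := Fin.ext hidx
  by_cases h : 1 ≤ (x.2 : ℕ)
  · rw [evenToOdd, dif_pos, jordanShift, if_pos h]
    · exact congrArg some (sigma_fin_ext hidx rfl)
    · refine ⟨by dsimp only; omega, h, by dsimp only; omega, ?_⟩
      dsimp only
      rw [hfin]
      omega
  · rw [evenToOdd, dif_neg (fun h' => h h'.2.1), jordanShift, if_neg h]

/-- The pairing enters here: the odd chain is at most one shorter, so it has a vector one level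
down. An unpaired last chain has length one, so both sides vanish on it. -/
theorem evenToOdd_bind_oddToEven (hκ : PairedSizes κ) {x : Σ i : Fin d, Fin (κ i)}
    (hx : (x.1 : ℕ) % 2 = 0) : (evenToOdd κ x).bind (oddToEven κ) = jordanShift κ 1 x := by
  by_cases h : 1 ≤ (x.2 : ℕ)
  · have hx2 := x.2.2
    have hj : 2 * ((x.1 : ℕ) / 2) = x.1 := by omega
    have hd : (x.1 : ℕ) + 1 < d := by
      by_contra hd
      have h1 := hκ.2 (x.1 / 2) (by omega)
      simp only [hj, Fin.eta] at h1
      omega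
    have hlt : (x.2 : ℕ) - 1 < κ ⟨x.1 + 1, hd⟩ := by
      have h1 := hκ.1 (x.1 / 2) (by omega)
      simp only [hj, Fin.eta] at h1
      omega
    rw [evenToOdd, dif_pos ⟨hx, h, hd, hlt⟩, Option.bind_some, oddToEven, dif_pos, jordanShift,
      if_pos h]
    · exact congrArg some (sigma_fin_ext (Nat.add_sub_cancel _ _) rfl)
    · refine ⟨by dsimp only; omega, ?_⟩
      simp only [Nat.add_sub_cancel, Fin.eta]
      omega
  · rw [evenToOdd, dif_neg (fun h' => h h'.2.1), jordanShift, if_neg h]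
    rfl

theorem partialMapMatrix_evenToOdd_sq :
    partialMapMatrix (evenToOdd κ) * partialMapMatrix (evenToOdd κ) = 0 := by
  simp only [partialMapMatrix_mul, evenToOdd_bind_evenToOdd, partialMapMatrix_none]

theorem partialMapMatrix_oddToEven_sq :
    partialMapMatrix (oddToEven κ) * partialMapMatrix (oddToEven κ) = 0 := by
  simp only [partialMapMatrix_mul, oddToEven_bind_oddToEven, partialMapMatrix_none]

theorem jordanSum_eq_anticommutator (hκ : Antitone κ) (hp : PairedSizes κ) :
    partialMapMatrix (evenToOdd κ) * partialMapMatrix (oddToEven κ) +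
      partialMapMatrix (oddToEven κ) * partialMapMatrix (evenToOdd κ) = jordanSum κ := by
  rw [partialMapMatrix_mul, partialMapMatrix_mul, jordanSum_eq_partialMapMatrix]
  ext x y
  simp only [Matrix.add_apply, partialMapMatrix_apply]
  rcases Nat.mod_two_eq_zero_or_one y.1 with hy | hy
  · simp [evenToOdd_bind_oddToEven hp hy, oddToEven_of_even hy]
  · simp [oddToEven_bind_evenToOdd hκ hy, evenToOdd_of_odd hy]

theorem exists_sq_eq_jordanSum (hκ : Antitone κ) (hp : PairedSizes κ) :
    ∃ X, X ^ 2 = jordanSum κ := by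
  refine ⟨partialMapMatrix (evenToOdd κ) + partialMapMatrix (oddToEven κ), ?_⟩
  rw [← jordanSum_eq_anticommutator hκ hp, pow_two, add_mul, mul_add, mul_add,
    partialMapMatrix_evenToOdd_sq, partialMapMatrix_oddToEven_sq, zero_add, add_zero]

theorem jordanSum_mem_commutatorsOf (hκ : Antitone κ) (hp : PairedSizes κ) :
    jordanSum κ ∈ commutatorsOf (squareZeroSet (Matrix _ _ ℂ)) := by
  set A := partialMapMatrix (evenToOdd κ) with hA
  set B := partialMapMatrix (oddToEven κ) with hB
  -- `A` lowers the level by one and `B` keeps it, so `D` anticommutes with `A` and commutes with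
  -- `B`. Hence `(A D) (B D) = A B` while `(B D) (A D) = -(B A)`.
  set D : Matrix (Σ i : Fin d, Fin (κ i)) (Σ i : Fin d, Fin (κ i)) ℂ :=
    Matrix.diagonal fun x => (-1) ^ (x.2 : ℕ) with hD
  have hDD : D * D = 1 := by
    rw [hD, Matrix.diagonal_mul_diagonal, ← Matrix.diagonal_one]
    congr 1
    ext1 x
    rw [← mul_pow]
    simp
  have hDA : D * A = -(A * D) := by
    ext x y
    rw [Matrix.neg_apply, hD, Matrix.diagonal_mul, Matrix.mul_diagonal, hA,
      partialMapMatrix_apply]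
    split_ifs with h
    · rw [(evenToOdd_eq_some h).2.2, pow_succ]
      ring
    · simp
  have hDB : D * B = B * D := by
    ext x y
    rw [hD, Matrix.diagonal_mul, Matrix.mul_diagonal, hB, partialMapMatrix_apply]
    split_ifs with h
    · rw [(oddToEven_eq_some h).2.2]
      ring
    · simp
  have hDAD : D * (A * D) = -A := by
    rw [← mul_assoc, hDA, neg_mul, mul_assoc, hDD, mul_one]
  have hDBD : D * (B * D) = B := by
    rw [← mul_assoc, hDB, mul_assoc, hDD, mul_one]
  refine ⟨A * D, ?_, B * D, ?_, ?_⟩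
  · change (A * D) ^ 2 = 0
    rw [pow_two, mul_assoc, hDAD, mul_neg, partialMapMatrix_evenToOdd_sq, neg_zero]
  · change (B * D) ^ 2 = 0
    rw [pow_two, mul_assoc, hDBD, partialMapMatrix_oddToEven_sq]
  · rw [mul_assoc, mul_assoc, hDAD, hDBD, mul_neg, sub_neg_eq_add,
      jordanSum_eq_anticommutator hκ hp]

end Sufficiency

/-! ### Existence of the Jordan form with decreasing block sizes. -/

section JordanForm

open Polynomial in
/-- The basis `X ^ (k - 1), …, X, 1` of `K[X] ⧸ (X ^ k)`. -/
theorem exists_basis_quotient_span_X_pow (K : Type*) [Field K] (k : ℕ) :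
    ∃ b : Basis (Fin k) K (K[X] ⧸ Submodule.span K[X] {(X : K[X]) ^ k}),
      ∀ j : Fin k, (X : K[X]) • b j =
        if 1 ≤ (j : ℕ) then b ⟨j - 1, by omega⟩ else 0 := by
  have hg : (X ^ k : K[X]).Monic := monic_X_pow k
  -- The power basis is reversed so that multiplication by `X` lowers the index, matching ones on
  -- the superdiagonal.
  let b₀ : Basis (Fin k) K (AdjoinRoot (X ^ k : K[X])) :=
    ((AdjoinRoot.powerBasis' hg).basis.reindex
      (finCongr (natDegree_X_pow k))).reindex Fin.revPerm
  have hb (j : Fin k) : b₀ j = AdjoinRoot.mk (X ^ k : K[X]) (X ^ (k - (j + 1))) := by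
    simp only [b₀, Basis.reindex_apply, PowerBasis.coe_basis, AdjoinRoot.powerBasis'_gen,
      map_pow, AdjoinRoot.mk_X]
    rfl
  let π : K[X] →ₗ[K[X]] K[X] ⧸ Submodule.span K[X] {(X : K[X]) ^ k} := Submodule.mkQ _
  have hX (f : K[X]) : (X : K[X]) • π f = π (X * f) := rfl
  replace hb (j : Fin k) : b₀ j = π (X ^ (k - (j + 1))) := hb j
  refine ⟨b₀, fun j => ?_⟩
  trans π (X * X ^ (k - (j + 1)))
  · exact (congrArg (fun z : K[X] ⧸ Submodule.span K[X] {(X : K[X]) ^ k} => (X : K[X]) • z)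
      (hb j)).trans (hX _)
  rw [← pow_succ']
  split_ifs with h
  · refine Eq.trans ?_ (hb _).symm
    congr 2
    dsimp only
    omega
  · rw [show k - (j + 1) + 1 = k by omega]
    exact AdjoinRoot.mk_self

open Polynomial in
theorem exists_jordan_basis {K V : Type*} [Field K] [AddCommGroup V] [Module K V]
    [FiniteDimensional K V] {f : End K V} (hf : IsNilpotent f) :
    ∃ (d : ℕ) (k : Fin d → ℕ) (b : Basis (Σ i : Fin d, Fin (k i)) K V),
      ∀ x, f (b x) = if 1 ≤ (x.2 : ℕ) then b ⟨x.1, ⟨x.2 - 1, by omega⟩⟩ else 0 := by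
  obtain ⟨m, hm⟩ := hf
  -- Nilpotency makes `V`, with `X` acting as `f`, an `X`-power torsion `K[X]`-module, hence a sum
  -- of modules `K[X] ⧸ (X ^ k i)`.
  have htors : Module.IsTorsion' (AEval' f) (Submonoid.powers (X : K[X])) := by
    intro x
    refine ⟨⟨X ^ m, m, rfl⟩, ?_⟩
    obtain ⟨x, rfl⟩ := (AEval'.of f).surjective x
    change (X ^ m : K[X]) • AEval'.of f x = 0
    rw [AEval'.X_pow_smul_of, hm, zero_smul, map_zero]
  obtain ⟨d, k, ⟨e⟩⟩ := Module.torsion_by_prime_power_decomposition irreducible_X htors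
  choose c hc using fun i => exists_basis_quotient_span_X_pow K (k i)
  let e' : AEval' f ≃ₗ[K[X]] (∀ i, K[X] ⧸ Submodule.span K[X] {(X : K[X]) ^ k i}) :=
    e.trans (DirectSum.linearEquivFunOnFintype K[X] (Fin d) _)
  let b : Basis (Σ i : Fin d, Fin (k i)) K V :=
    (Pi.basis c).map ((AEval'.of f).trans (e'.restrictScalars K)).symm
  have hb (x) : AEval'.of f (b x) = e'.symm (Pi.basis c x) := by
    simp [b]
  refine ⟨d, k, b, fun x => ?_⟩
  apply (AEval'.of f).injective
  rw [← AEval'.X_smul_of, hb, ← map_smul]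
  have hX : (X : K[X]) • Pi.basis c x =
      if 1 ≤ (x.2 : ℕ) then Pi.basis c ⟨x.1, ⟨x.2 - 1, by omega⟩⟩ else 0 := by
    rw [Pi.basis_apply, ← Pi.single_smul, hc]
    split_ifs with h
    · rw [Pi.basis_apply]
    · rw [Pi.single_zero]
  rw [hX]
  split_ifs with h
  · rw [hb]
  · rw [map_zero, map_zero]

/-- The positive values of a tuple can be listed in decreasing order. -/
theorem exists_antitone_enumeration_pos {d : ℕ} (k : Fin d → ℕ) :
    ∃ (d' : ℕ) (g : Fin d' → Fin d), Function.Injective g ∧ Antitone (k ∘ g) ∧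
      ∀ i, 1 ≤ k i ↔ i ∈ Set.range g := by
  let ε := (Fintype.equivFin {i // 1 ≤ k i}).symm
  let s : Fin (Fintype.card {i // 1 ≤ k i}) → ℕᵒᵈ := fun i => OrderDual.toDual (k (ε i))
  refine ⟨_, fun i => ε (Tuple.sort s i), ?_, ?_, fun i => ⟨fun hi => ?_, ?_⟩⟩
  · exact Subtype.val_injective.comp (ε.injective.comp (Tuple.sort s).injective)
  · exact fun i j hij => OrderDual.toDual_le_toDual.1 (Tuple.monotone_sort s hij)
  · exact ⟨(Tuple.sort s).symm (ε.symm ⟨i, hi⟩), by simp⟩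
  · rintro ⟨j, rfl⟩
    exact (ε (Tuple.sort s j)).2

theorem exists_sorted_jordan_basis {K V : Type*} [Field K] [AddCommGroup V] [Module K V]
    [FiniteDimensional K V] {f : End K V} (hf : IsNilpotent f) :
    ∃ (d : ℕ) (κ : Fin d → ℕ), Antitone κ ∧ (∀ i, 1 ≤ κ i) ∧
      ∃ b : Basis (Σ i : Fin d, Fin (κ i)) K V,
        ∀ x, f (b x) = if 1 ≤ (x.2 : ℕ) then b ⟨x.1, ⟨x.2 - 1, by omega⟩⟩ else 0 := by
  obtain ⟨d, k, b, hb⟩ := exists_jordan_basis hf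
  -- The decomposition may contain zero summands with `k i = 0`; dropping them loses no basis
  -- vector.
  obtain ⟨d', g, hg, hanti, hrange⟩ := exists_antitone_enumeration_pos k
  let θ : (Σ i : Fin d', Fin ((k ∘ g) i)) ≃ Σ i : Fin d, Fin (k i) :=
    Equiv.ofBijective (fun x => ⟨g x.1, x.2⟩) (by
      constructor
      · rintro ⟨i, a⟩ ⟨j, a'⟩ h
        simp only [Sigma.mk.injEq] at h
        obtain rfl := hg h.1
        obtain rfl := eq_of_heq h.2
        rfl
      · rintro ⟨i, a⟩
        obtain ⟨j, rfl⟩ := (hrange i).1 a.pos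
        exact ⟨⟨j, a⟩, rfl⟩)
  refine ⟨d', k ∘ g, hanti, fun i => (hrange (g i)).2 ⟨i, rfl⟩, b.reindex θ.symm, fun x => ?_⟩
  simp only [Basis.reindex_apply, Equiv.symm_symm]
  exact hb _

theorem exists_hasJordanBlockSizes {n : ℕ} {J : Matrix (Fin n) (Fin n) ℂ} (hJ : IsNilpotent J) :
    ∃ (d : ℕ) (κ : Fin d → ℕ), HasJordanBlockSizes J κ := by
  have hf : IsNilpotent (Matrix.toLin' J) := by
    obtain ⟨m, hm⟩ := hJ
    exact ⟨m, by rw [← Matrix.toLin'_pow, hm, map_zero]⟩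
  obtain ⟨d, κ, hκ, hpos, b, hb⟩ := exists_sorted_jordan_basis hf
  let e := b.indexEquiv (Pi.basisFun ℂ (Fin n))
  let c := Pi.basisFun ℂ (Fin n)
  let b' := b.reindex e
  refine ⟨d, κ, hκ, hpos, e, ⟨⟨b'.toMatrix c, c.toMatrix b', b'.toMatrix_mul_toMatrix_flip c,
    c.toMatrix_mul_toMatrix_flip b'⟩, ?_⟩⟩
  have h1 : LinearMap.toMatrix b' b' (Matrix.toLin' J) = Matrix.reindex e e (jordanSum κ) := by
    ext x y
    rw [LinearMap.toMatrix_apply, Matrix.reindex_apply, Matrix.submatrix_apply,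
      jordanSum_eq_partialMapMatrix, partialMapMatrix_apply]
    simp only [b', Basis.reindex_apply, Basis.repr_reindex_apply, hb, jordanShift]
    split_ifs with h2 h3 h3
    · rw [Basis.repr_self, ← Option.some.inj h3, Finsupp.single_eq_same]
    · rw [Basis.repr_self, Finsupp.single_eq_of_ne]
      exact fun h4 => h3 (by rw [h4])
    · cases h3
    · simp
  have h2 : LinearMap.toMatrix c c (Matrix.toLin' J) = J := by
    rw [LinearMap.toMatrix_eq_toMatrix', LinearMap.toMatrix'_toLin']
  change b'.toMatrix c * J = Matrix.reindex e e (jordanSum κ) * b'.toMatrix c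
  rw [← h1, linearMap_toMatrix_mul_basis_toMatrix]
  conv_lhs => rw [← h2]
  rw [basis_toMatrix_mul_linearMap_toMatrix]

end JordanForm

theorem theorem3p15 (n : ℕ) (hn : 2 ≤ n) (J : Matrix (Fin n) (Fin n) ℂ) (hJ : IsNilpotent J) :
    (J ∈ commutatorsOf (squareZeroSet (Matrix (Fin n) (Fin n) ℂ)) ↔
      ∃ X : Matrix (Fin n) (Fin n) ℂ, X ^ 2 = J) ∧
    (∃ (d : ℕ) (κ : Fin d → ℕ), HasJordanBlockSizes J κ) ∧
    ∀ (d : ℕ) (κ : Fin d → ℕ), HasJordanBlockSizes J κ →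
      (J ∈ commutatorsOf (squareZeroSet (Matrix (Fin n) (Fin n) ℂ)) ↔ PairedSizes κ) := by
  have hcomm (d : ℕ) (κ : Fin d → ℕ) (h : HasJordanBlockSizes J κ) :
      J ∈ commutatorsOf (squareZeroSet (Matrix (Fin n) (Fin n) ℂ)) ↔ PairedSizes κ := by
    obtain ⟨φ, hφ⟩ := h.exists_ringEquiv
    rw [← φ.mem_commutatorsOf_squareZeroSet_iff, hφ]
    exact ⟨pairedSizes_of_jordanSum_mem h.1 h.2.1, jordanSum_mem_commutatorsOf h.1⟩
  have hsq (d : ℕ) (κ : Fin d → ℕ) (h : HasJordanBlockSizes J κ) :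
      (∃ X : Matrix (Fin n) (Fin n) ℂ, X ^ 2 = J) ↔ PairedSizes κ := by
    obtain ⟨φ, hφ⟩ := h.exists_ringEquiv
    rw [← φ.exists_sq_eq_iff, hφ]
    exact ⟨pairedSizes_of_sq_eq_jordanSum h.1 h.2.1, exists_sq_eq_jordanSum h.1⟩
  obtain ⟨d, κ, h⟩ := exists_hasJordanBlockSizes hJ
  exact ⟨(hcomm d κ h).trans (hsq d κ h).symm, ⟨d, κ, h⟩, hcomm⟩
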